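/- Let $1<s\le 2$, let $T(x)=\min\{sx,\,s(1-x)\}$ be the tent map on $[0,1]$ with critical point $c=\tfrac12$, write $c_k=T^k(c)$, and assume that the orbit of $c$ is infinite. Let $\omega(c)$ be the omega-limit set of $c$. For $S\subset[0,1]$ let $$\varprojlim(S,T)=\{(x_0,x_{-1},x_{-2},\dots): x_{-i}\in S,\ T(x_{-i-1})=x_{-i}\text{ for all } i\ge 0\}$$ with the product topology, and put $X=\varprojlim([0,1],T)$ and $X'=\varprojlim([c_2,c_1],T)\subset X$. Let $\mathcal E$ be the set of endpoints of $X$, i.e. of those $x\in X$ such that any two subcontinua (non-empty compact connected subsets) $A,B\subset X$ containing $x$ satisfy $A\subset B$ or $B\subset A$. Let $\mathcal F$ be the set of folding points, i.e. of those $x\in X'$ that have no neighbourhood in $X'$ homeomorphic to the product of a Cantor set and an open arc. If $\mathcal F\setminus\mathcal E\neq\emptyset$, then $\mathcal F\setminus\mathcal E$ is dense in $\mathcal F$. The same holds if $\mathcal F$ is replaced by $\varprojlim(\omega(c),T)$ (which describes the folding points by their projections): if $\varprojlim(\omega(c),T)\setminus\mathcal E\ne\emptyset$, then this set is dense in $\varprojlim(\omega(c),T)$.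 -/

import Mathlib

open Set Topology Filter

noncomputable section

namespace TentInverseLimit

/-- The symmetric tent map of slope `s`, considered for points of `[0,1]`. -/
def tent (s : ℝ) (x : ℝ) : ℝ := min (s * x) (s * (1 - x))

/-- The critical point of every tent map. -/
def crit : ℝ := 1 / 2

/-- The points `c_k = T^k(c)` of the critical orbit. -/
def critOrbit (s : ℝ) (k : ℕ) : ℝ := (tent s)^[k] crit

/-- The inverse limit of `T` on `S`, i.e. the set of all backward orbits of `T` in `S`.
The coordinate `x i` is the projection `π_i(x)`, written `x_{-i}` when backward orbits are
indexed by the non-positive integers.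
All topological notions refer to the product topology of `ℕ → ℝ`. -/
def invLim (T : ℝ → ℝ) (S : Set ℝ) : Set (ℕ → ℝ) :=
  {x | (∀ i, x i ∈ S) ∧ ∀ i, T (x (i + 1)) = x i}

/-- The inverse limit space `X` of the tent map on `[0,1]`. -/
def space (s : ℝ) : Set (ℕ → ℝ) := invLim (tent s) (Icc 0 1)

/-- The core inverse limit space `X'`, the inverse limit of `T` on the core `[c_2, c_1]`. -/
def coreSpace (s : ℝ) : Set (ℕ → ℝ) :=
  invLim (tent s) (Icc (critOrbit s 2) (critOrbit s 1))

/-- The omega-limit set `ω(c)` of the critical point. -/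
def omegaCrit (s : ℝ) : Set ℝ :=
  omegaLimit atTop (fun (n : ℕ) (x : ℝ) => (tent s)^[n] x) {crit}

/-- A subcontinuum of `Y`: a non-empty compact connected subset (`IsConnected` includes
non-emptiness). -/
def IsSubcontinuum {E : Type*} [TopologicalSpace E] (Y A : Set E) : Prop :=
  A ⊆ Y ∧ IsCompact A ∧ IsConnected A

/-- The set of endpoints of `Y`: points at which any two subcontinua of `Y` are nested. -/
def endpoints {E : Type*} [TopologicalSpace E] (Y : Set E) : Set E :=
  {x | x ∈ Y ∧ ∀ A B : Set E, IsSubcontinuum Y A → IsSubcontinuum Y B →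
    x ∈ A → x ∈ B → A ⊆ B ∨ B ⊆ A}

/-- A Cantor set: a non-empty, compact, totally disconnected set without isolated points. -/
def IsCantor {E : Type*} [TopologicalSpace E] (K : Set E) : Prop :=
  K.Nonempty ∧ IsCompact K ∧ Perfect K ∧ IsTotallyDisconnected K

/-- The point `x` has a neighbourhood in `Y` which is homeomorphic to the product of a Cantor set
and an open arc. Since all Cantor sets are homeomorphic, it does not matter that `K` is taken
from `ℕ → ℝ`. -/
def HasCantorArcNhd {E : Type*} [TopologicalSpace E] (Y : Set E) (x : E) : Prop :=
  ∃ U : Set E, U ⊆ Y ∧ U ∈ 𝓝[Y] x ∧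
    ∃ K : Set (ℕ → ℝ), IsCantor K ∧ Nonempty (U ≃ₜ K × Ioo (0 : ℝ) 1)

/-- The set of folding points: the points of `X'` without a neighbourhood in `X'` that is
homeomorphic to the product of a Cantor set and an open arc. -/
def foldingPoints (s : ℝ) : Set (ℕ → ℝ) :=
  {x | x ∈ coreSpace s ∧ ¬ HasCantorArcNhd (coreSpace s) x}

/-- The inverse limit of `T` restricted to `ω(c)`. -/
def omegaSpace (s : ℝ) : Set (ℕ → ℝ) := invLim (tent s) (omegaCrit s)

end TentInverseLimit

end

/-!
A backward orbit in the core that stays in a compact set off the critical point `c` moves along an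
arc, since the inverse branches contract; hence it is no endpoint. Let `D` be the set of coordinates
of non-endpoints of `lim ω(c)`. If `c ∈ ω(c)` had a neighbourhood missing `D`, then the critical
orbit would follow a non-endpoint near `D` for longer and longer times and leave every time;
a limit of these stretches is a backward orbit in `ω(c)` which stays near `D`, hence is not an
endpoint, but whose image is not near `D`, a contradiction. So `D` is dense in `ω(c)`, and as `D`
comes from any coordinate, the non-endpoints are dense in `lim ω(c)`.

Points of `lim ω(c)` are folding points because arcs nearby fold at coordinates equal to `c`. Away
from the critical orbit the core inverse limit is a product of a fibre with an interval. For
`s² ≥ 2` the fibres are Cantor sets, so the folding points are exactly `lim ω(c)`. For `s² < 2` the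
fixed point `p > c` lies in `(c₂, c₃)`, where every point has a single preimage in the core; so a
backward orbit that is eventually on the right of `c` converges to `p` and has an arc as a
neighbourhood. It is therefore a folding point and not an endpoint, and such orbits are dense.
-/

namespace TentInverseLimit

/-! ### The tent map and its core -/

lemma continuous_tent (s : ℝ) : Continuous (tent s) := by
  unfold tent; fun_prop

lemma tent_of_le_crit {s x : ℝ} (hs : 0 ≤ s) (hx : x ≤ crit) : tent s x = s * x := by
  unfold crit at hx
  exact min_eq_left (by gcongr; linarith)

lemma tent_of_crit_le {s x : ℝ} (hs : 0 ≤ s) (hx : crit ≤ x) : tent s x = s * (1 - x) := by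
  unfold crit at hx
  exact min_eq_right (by gcongr; linarith)

lemma eq_div_of_tent_eq {s x u : ℝ} (hs : 0 < s) (hx : x ≤ crit) (h : tent s x = u) :
    x = u / s := by
  rw [tent_of_le_crit hs.le hx] at h
  rw [eq_div_iff hs.ne', mul_comm, h]

lemma eq_one_sub_div_of_tent_eq {s x u : ℝ} (hs : 0 < s) (hx : crit ≤ x) (h : tent s x = u) :
    x = 1 - u / s := by
  rw [tent_of_crit_le hs.le hx] at h
  rw [← h, mul_div_cancel_left₀ _ hs.ne', sub_sub_cancel]

lemma finite_tent_preimage {s : ℝ} (hs : 0 < s) (u : ℝ) : (tent s ⁻¹' {u}).Finite := by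
  refine (toFinite {u / s, 1 - u / s}).subset fun x hx => ?_
  exact (le_total x crit).imp (eq_div_of_tent_eq hs · hx) (eq_one_sub_div_of_tent_eq hs · hx)

lemma critOrbit_succ (s : ℝ) (k : ℕ) : critOrbit s (k + 1) = tent s (critOrbit s k) :=
  Function.iterate_succ_apply' _ _ _

lemma critOrbit_one {s : ℝ} (hs : 0 ≤ s) : critOrbit s 1 = s / 2 := by
  rw [critOrbit_succ, show critOrbit s 0 = crit from rfl, tent_of_le_crit hs le_rfl, crit]
  ring

lemma critOrbit_two {s : ℝ} (hs : 1 ≤ s) : critOrbit s 2 = s * (1 - s / 2) := by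
  rw [critOrbit_succ, critOrbit_one (by linarith),
    tent_of_crit_le (by linarith) (by unfold crit; linarith)]

lemma critOrbit_two_le_crit {s : ℝ} (hs : 1 ≤ s) : critOrbit s 2 ≤ crit := by
  rw [critOrbit_two hs, crit]; nlinarith [sq_nonneg (s - 1)]

lemma critOrbit_three {s : ℝ} (hs : 1 ≤ s) : critOrbit s 3 = s * critOrbit s 2 := by
  rw [critOrbit_succ, tent_of_le_crit (by linarith) (critOrbit_two_le_crit hs)]

lemma critOrbit_two_nonneg {s : ℝ} (hs : 1 ≤ s) (hs2 : s ≤ 2) : 0 ≤ critOrbit s 2 := by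
  rw [critOrbit_two hs]; nlinarith

lemma tent_le_critOrbit_one {s : ℝ} (hs : 0 ≤ s) (x : ℝ) : tent s x ≤ critOrbit s 1 := by
  rw [critOrbit_one hs]
  rcases le_total x crit with h | h
  · rw [tent_of_le_crit hs h]; unfold crit at h; nlinarith
  · rw [tent_of_crit_le hs h]; unfold crit at h; nlinarith

lemma mapsTo_tent_unitInterval {s : ℝ} (hs : 0 ≤ s) (hs2 : s ≤ 2) :
    MapsTo (tent s) (Icc 0 1) (Icc 0 1) := fun x hx => by
  refine ⟨le_min (mul_nonneg hs hx.1) (mul_nonneg hs (sub_nonneg.2 hx.2)), ?_⟩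
  have := tent_le_critOrbit_one hs x
  rw [critOrbit_one hs] at this
  linarith

/-- The core `[c₂, c₁]`, on which the tent map is surjective. -/
abbrev core (s : ℝ) : Set ℝ := Icc (critOrbit s 2) (critOrbit s 1)

lemma mapsTo_tent_core {s : ℝ} (hs : 1 ≤ s) (hs2 : s ≤ 2) : MapsTo (tent s) (core s) (core s) := by
  intro x hx
  have hs0 : 0 ≤ s := by linarith
  have h2 := critOrbit_two_nonneg hs hs2
  refine ⟨?_, tent_le_critOrbit_one hs0 x⟩
  rcases le_total x crit with h | h
  · rw [tent_of_le_crit hs0 h]; nlinarith [hx.1]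
  · rw [tent_of_crit_le hs0 h, critOrbit_succ, critOrbit_one hs0,
      tent_of_crit_le hs0 (by unfold crit; linarith)]
    gcongr
    exact hx.2.trans_eq (critOrbit_one hs0)

lemma critOrbit_mem_core {s : ℝ} (hs : 1 ≤ s) (hs2 : s ≤ 2) (n : ℕ) : critOrbit s n ∈ core s :=
  (mapsTo_tent_core hs hs2).iterate n
    ⟨critOrbit_two_le_crit hs, by rw [critOrbit_one (by linarith), crit]; linarith⟩

lemma core_subset_Icc {s : ℝ} (hs : 1 ≤ s) (hs2 : s ≤ 2) : core s ⊆ Icc 0 1 :=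
  Icc_subset_Icc (critOrbit_two_nonneg hs hs2) (by rw [critOrbit_one (by linarith)]; linarith)

/-! ### Backward orbits -/

section InvLim

variable {T : ℝ → ℝ} {S S' : Set ℝ} {x y : ℕ → ℝ}

lemma invLim_mono (h : S ⊆ S') : invLim T S ⊆ invLim T S' :=
  fun _ hx => ⟨fun i => h (hx.1 i), hx.2⟩

lemma iterate_apply_of_mem_invLim (hx : x ∈ invLim T S) (i n : ℕ) : T^[n] (x (i + n)) = x i := by
  induction n with
  | zero => rfl
  | succ n ih => rw [Function.iterate_succ_apply, ← Nat.add_assoc, hx.2, ih]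

lemma iterate_sub_apply_of_mem_invLim (hx : x ∈ invLim T S) {i n : ℕ} (h : i ≤ n) :
    T^[n - i] (x n) = x i := by
  obtain ⟨k, rfl⟩ := Nat.exists_eq_add_of_le h
  rw [Nat.add_sub_cancel_left, iterate_apply_of_mem_invLim hx]

lemma drop_mem_invLim (hx : x ∈ invLim T S) (N : ℕ) : (fun l => x (N + l)) ∈ invLim T S :=
  ⟨fun l => hx.1 (N + l), fun l => hx.2 (N + l)⟩

/-- The homeomorphism of the inverse limit induced by `T`. -/
def shift (T : ℝ → ℝ) (x : ℕ → ℝ) : ℕ → ℝ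
  | 0 => T (x 0)
  | n + 1 => x n

lemma continuous_shift (hT : Continuous T) : Continuous (shift T) := by
  refine continuous_pi fun i => ?_
  cases i with
  | zero => exact hT.comp (continuous_apply 0)
  | succ n => exact continuous_apply n

lemma injective_shift : Function.Injective (shift T) :=
  fun _ _ h => funext fun i => congrFun h (i + 1)

lemma mapsTo_shift (hT : MapsTo T S S) : MapsTo (shift T) (invLim T S) (invLim T S) := by
  intro x hx
  constructor <;> rintro (_ | i)
  exacts [hT (hx.1 0), hx.1 i, rfl, hx.2 i]

lemma iterate_shift_apply_add (x : ℕ → ℝ) (N l : ℕ) : (shift T)^[N] x (N + l) = x l := by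
  induction N with
  | zero => simp
  | succ N ih => rw [Function.iterate_succ_apply', Nat.succ_add]; exact ih

lemma iterate_shift_apply_self (x : ℕ → ℝ) (N : ℕ) : (shift T)^[N] x N = x 0 :=
  iterate_shift_apply_add x N 0

lemma iterate_shift_apply_of_le (x : ℕ → ℝ) {N i : ℕ} (h : i ≤ N) :
    (shift T)^[N] x i = T^[N - i] (x 0) := by
  induction N generalizing i with
  | zero => obtain rfl := Nat.le_zero.1 h; rfl
  | succ N ih =>
    rw [Function.iterate_succ_apply']
    cases i with
    | zero => rw [Nat.sub_zero, Function.iterate_succ_apply']; exact congrArg T (ih N.zero_le)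
    | succ i => rw [Nat.add_sub_add_right]; exact ih (Nat.succ_le_succ_iff.1 h)

lemma iterate_shift_drop (hx : x ∈ invLim T S) (N : ℕ) :
    (shift T)^[N] (fun l => x (N + l)) = x := by
  funext i
  rcases le_total i N with h | h
  · rw [iterate_shift_apply_of_le _ h]; exact iterate_sub_apply_of_mem_invLim hx h
  · obtain ⟨l, rfl⟩ := Nat.exists_eq_add_of_le h
    exact iterate_shift_apply_add _ N l

lemma isClosed_invLim (hT : Continuous T) (hS : IsClosed S) : IsClosed (invLim T S) := by
  simp only [invLim, ofPred_and, ofPred_forall]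
  exact (isClosed_iInter fun i => hS.preimage (continuous_apply i)).inter
    (isClosed_iInter fun i => isClosed_eq (hT.comp (continuous_apply _)) (continuous_apply i))

lemma isCompact_invLim (hT : Continuous T) (hS : IsCompact S) : IsCompact (invLim T S) :=
  (isCompact_univ_pi fun _ => hS).of_isClosed_subset (isClosed_invLim hT hS.isClosed)
    fun _ hx i _ => hx.1 i

lemma mem_closure_of_frequently_apply {R : Set (ℕ → ℝ)} (hT : Continuous T) (hR : R ⊆ invLim T S)
    (hy : y ∈ invLim T S') (h : ∃ᶠ M in atTop, y M ∈ closure ((· M) '' R)) : y ∈ closure R := by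
  refine mem_closure_iff_nhds.2 fun V hV => ?_
  rw [nhds_pi, Filter.mem_pi] at hV
  obtain ⟨I, hI, t, ht, htV⟩ := hV
  obtain ⟨m, hm⟩ := hI.bddAbove
  obtain ⟨M, hMm, hM⟩ := frequently_atTop.1 h m
  have hev : ∀ᶠ v in 𝓝 (y M), ∀ i ∈ I, T^[M - i] v ∈ t i := by
    refine (hI.eventually_all).2 fun i hi => (hT.iterate _).continuousAt ?_
    rw [iterate_sub_apply_of_mem_invLim hy ((hm hi).trans hMm)]
    exact ht i
  obtain ⟨-, hv, z, hz, rfl⟩ := mem_closure_iff_nhds.1 hM _ hev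
  refine ⟨z, htV fun i hi => ?_, hz⟩
  have hzi := hv i hi
  rwa [iterate_sub_apply_of_mem_invLim (hR hz) ((hm hi).trans hMm)] at hzi

lemma finite_iterate_preimage (hT : ∀ u, (T ⁻¹' {u}).Finite) (n : ℕ) (u : ℝ) :
    (T^[n] ⁻¹' {u}).Finite := by
  induction n with
  | zero => exact finite_singleton u
  | succ n ih =>
    rw [Function.iterate_succ, preimage_comp]
    exact ih.preimage' fun v _ => hT v

lemma isTotallyDisconnected_fibre (hT : ∀ u, (T ⁻¹' {u}).Finite) (N : ℕ) (p : ℝ) :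
    IsTotallyDisconnected {y ∈ invLim T S | y N = p} := by
  intro A hA hAc a ha b hb
  funext i
  refine (finite_iterate_preimage hT i (T^[N] p)).countable.isTotallyDisconnected _ ?_
    (hAc.image _ (continuous_apply i).continuousOn) (mem_image_of_mem _ ha) (mem_image_of_mem _ hb)
  rintro _ ⟨y, hy, rfl⟩
  obtain ⟨hyS, rfl⟩ := hA hy
  have hi := iterate_apply_of_mem_invLim hyS 0 i
  have hN := iterate_apply_of_mem_invLim hyS 0 N
  rw [Nat.zero_add] at hi hN
  exact hi.trans hN.symm

end InvLim

/-! ### Endpoints -/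

section Endpoints

variable {E F : Type*} [TopologicalSpace E] [TopologicalSpace F] {f : E → F} {Y A : Set E}
  {Z : Set F} {x : E}

lemma isSubcontinuum_image (hf : Continuous f) (hYZ : MapsTo f Y Z) (hA : IsSubcontinuum Y A) :
    IsSubcontinuum Z (f '' A) :=
  ⟨image_subset_iff.2 (hA.1.trans hYZ), hA.2.1.image hf, hA.2.2.image f hf.continuousOn⟩

lemma mem_endpoints_of_apply_mem (hf : Continuous f) (hinj : Function.Injective f)
    (hYZ : MapsTo f Y Z) (hx : x ∈ Y) (h : f x ∈ endpoints Z) : x ∈ endpoints Y := by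
  refine ⟨hx, fun A B hA hB hxA hxB => ?_⟩
  simpa only [image_subset_image_iff hinj] using
    h.2 _ _ (isSubcontinuum_image hf hYZ hA) (isSubcontinuum_image hf hYZ hB)
      (mem_image_of_mem f hxA) (mem_image_of_mem f hxB)

lemma apply_notMem_endpoints_of_mem_Ioo {γ : ℝ → E} {a b t : ℝ} (hγ : ContinuousOn γ (Icc a b))
    (hinj : InjOn γ (Icc a b)) (hmaps : MapsTo γ (Icc a b) Y) (ht : t ∈ Ioo a b) :
    γ t ∉ endpoints Y := by
  have hl : Icc a t ⊆ Icc a b := Icc_subset_Icc_right ht.2.le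
  have hr : Icc t b ⊆ Icc a b := Icc_subset_Icc_left ht.1.le
  have hsub : ∀ ⦃u v⦄, u ≤ v → Icc u v ⊆ Icc a b → IsSubcontinuum Y (γ '' Icc u v) :=
    fun u v huv h => ⟨(hmaps.mono_left h).image_subset, isCompact_Icc.image_of_continuousOn
      (hγ.mono h), (isConnected_Icc huv).image γ (hγ.mono h)⟩
  intro hE
  rcases hE.2 _ _ (hsub ht.1.le hl) (hsub ht.2.le hr) (mem_image_of_mem γ ⟨ht.1.le, le_rfl⟩)
    (mem_image_of_mem γ ⟨le_rfl, ht.2.le⟩) with h | h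
  · rw [hinj.image_subset_image_iff hl hr] at h
    exact ht.1.not_ge (h (left_mem_Icc.2 ht.1.le)).1
  · rw [hinj.image_subset_image_iff hr hl] at h
    exact ht.2.not_ge (h (right_mem_Icc.2 ht.2.le)).2

end Endpoints

/-! ### Backward orbits with a prescribed itinerary -/

/-- The backward orbit of `t` along the inverse branches of the tent map that `y` uses: its
coordinate `l + 1` lies on the same side of the critical point as `y (l + 1)`, as long as
coordinate `l` does not exceed `c₁`. -/
noncomputable def follow (s : ℝ) (y : ℕ → ℝ) (t : ℝ) : ℕ → ℝ
  | 0 => t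
  | l + 1 => if y (l + 1) ≤ crit then follow s y t l / s else 1 - follow s y t l / s

section Follow

variable {s t : ℝ} {x y : ℕ → ℝ} {S : Set ℝ} {l : ℕ}

lemma follow_congr (h : ∀ l, x (l + 1) ≤ crit ↔ y (l + 1) ≤ crit) :
    follow s x t = follow s y t := by
  funext l
  induction l with
  | zero => rfl
  | succ l ih => simp only [follow, h, ih]

lemma follow_self (hs : 0 < s) (hy : y ∈ invLim (tent s) S) : follow s y (y 0) = y := by
  funext l
  induction l with
  | zero => rfl
  | succ l ih =>
    rw [follow, ih]
    split_ifs with h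
    · exact (eq_div_of_tent_eq hs h (hy.2 l)).symm
    · exact (eq_one_sub_div_of_tent_eq hs (not_le.1 h).le (hy.2 l)).symm

lemma abs_follow_sub_follow (hs : 0 ≤ s) (t t' : ℝ) (l : ℕ) :
    |follow s y t l - follow s y t' l| = |t - t'| / s ^ l := by
  induction l with
  | zero => simp [follow]
  | succ l ih =>
    have hdiv : |follow s y t l / s - follow s y t' l / s| = |t - t'| / s ^ (l + 1) := by
      rw [← sub_div, abs_div, ih, abs_of_nonneg hs, div_div, pow_succ]
    simp only [follow]
    split_ifs
    · exact hdiv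
    · rwa [sub_sub_sub_cancel_left, abs_sub_comm]

lemma continuous_follow {Z : Type*} [TopologicalSpace Z] {y : Z → ℕ → ℝ} {t : Z → ℝ}
    (hy : Continuous y) (ht : Continuous t) (hne : ∀ z l, y z (l + 1) ≠ crit) :
    Continuous fun z => follow s (y z) (t z) := by
  refine continuous_pi fun l => ?_
  induction l with
  | zero => exact ht
  | succ l ih =>
    exact Continuous.if_le (ih.div_const s) (continuous_const.sub (ih.div_const s))
      ((continuous_apply (l + 1)).comp hy) continuous_const fun z hz => absurd hz (hne z l)

lemma div_le_crit (hs : 0 < s) (ht : t ≤ critOrbit s 1) : t / s ≤ crit := by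
  rw [critOrbit_one hs.le] at ht
  rw [div_le_iff₀ hs, crit]
  linarith

lemma tent_follow_succ (hs : 0 < s) (h : follow s y t l ≤ critOrbit s 1) :
    tent s (follow s y t (l + 1)) = follow s y t l := by
  have hdiv := div_le_crit hs h
  rw [follow]
  split_ifs
  · rw [tent_of_le_crit hs.le hdiv, mul_div_cancel₀ _ hs.ne']
  · rw [tent_of_crit_le hs.le (by unfold crit at *; linarith), sub_sub_cancel,
      mul_div_cancel₀ _ hs.ne']

lemma follow_le_critOrbit_one (hs : 0 < s)
    (h : follow s y t (l + 1) ≤ crit ↔ y (l + 1) ≤ crit) : follow s y t l ≤ critOrbit s 1 := by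
  have hdiv : follow s y t l / s ≤ crit := by
    rw [follow] at h
    split_ifs at h with hy
    · exact h.2 hy
    · have := (not_congr h).2 hy
      unfold crit at *
      linarith
  rw [div_le_iff₀ hs, crit] at hdiv
  rw [critOrbit_one hs.le]
  linarith

lemma follow_mem_invLim (hs : 0 < s) (hS : ∀ l, follow s y t l ∈ S)
    (hle : ∀ l, follow s y t l ≤ critOrbit s 1) : follow s y t ∈ invLim (tent s) S :=
  ⟨hS, fun l => tent_follow_succ hs (hle l)⟩

end Follow

/-! ### A criterion for non-endpoints -/

section NonEndpoint

variable {s : ℝ} {x : ℕ → ℝ} {C : Set ℝ}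

lemma notMem_endpoints_of_forall_mem (hs : 1 ≤ s) (hC : IsCompact C)
    (hC1 : C ⊆ Ioo 0 1 \ {crit}) (hx : x ∈ space s) (hxC : ∀ n, x n ∈ C) :
    x ∉ endpoints (space s) := by
  obtain ⟨η, hη, hηC⟩ := hC.exists_cthickening_subset_open
    (isOpen_Ioo.sdiff isClosed_singleton) hC1
  have hs0 : 0 < s := by linarith
  have hfollow : ∀ t ∈ Icc (x 0 - η) (x 0 + η), ∀ l, |follow s x t l - x l| ≤ η := by
    intro t ht l
    conv_lhs => rw [← congrFun (follow_self hs0 hx) l]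
    rw [abs_follow_sub_follow hs0.le]
    exact (div_le_self (abs_nonneg _) (one_le_pow₀ hs)).trans (abs_sub_le_iff.2
      ⟨by linarith [ht.2], by linarith [ht.1]⟩)
  have hball : ∀ l u, |u - x l| ≤ η → u ∈ Ioo 0 1 \ {crit} := fun l u hu =>
    hηC (Metric.closedBall_subset_cthickening (hxC l) η (by rwa [Metric.mem_closedBall,
      Real.dist_eq]))
  have hside : ∀ l u, |u - x l| ≤ η → (u ≤ crit ↔ x l ≤ crit) := by
    intro l u hu
    have hcrit : η < |crit - x l| := not_le.1 fun h => (hball l crit h).2 rfl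
    rw [abs_le] at hu
    rcases lt_abs.1 hcrit with h | h <;> constructor <;> intro <;> linarith
  have hmem : MapsTo (follow s x) (Icc (x 0 - η) (x 0 + η)) (space s) := fun t ht =>
    follow_mem_invLim hs0 (fun l => Ioo_subset_Icc_self (hball l _ (hfollow t ht l)).1)
      fun l => follow_le_critOrbit_one hs0 (hside (l + 1) _ (hfollow t ht (l + 1)))
  rw [← follow_self hs0 hx]
  refine apply_notMem_endpoints_of_mem_Ioo (Continuous.continuousOn ?_)
    (fun t _ t' _ h => congrFun h 0) hmem ⟨by linarith, by linarith⟩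
  exact continuous_follow continuous_const continuous_id fun _ l => (hC1 (hxC (l + 1))).2

lemma notMem_endpoints_of_eventually_mem (hs : 1 ≤ s) (hs2 : s ≤ 2) (hC : IsCompact C)
    (hC1 : C ⊆ Ioo 0 1 \ {crit}) (hx : x ∈ space s) (hxC : ∀ᶠ n in atTop, x n ∈ C) :
    x ∉ endpoints (space s) := by
  obtain ⟨N, hN⟩ := eventually_atTop.1 hxC
  have hdrop := drop_mem_invLim hx N
  intro h
  rw [← iterate_shift_drop hx N] at h
  exact notMem_endpoints_of_forall_mem hs hC hC1 hdrop (fun l => hN _ (Nat.le_add_right N l))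
    (mem_endpoints_of_apply_mem ((continuous_shift (continuous_tent s)).iterate N)
      (injective_shift.iterate N)
      ((mapsTo_shift (mapsTo_tent_unitInterval (by linarith) hs2)).iterate N) hdrop h)

end NonEndpoint

/-! ### Backward orbits leaving an open set -/

section Leaving

variable {α : Type*} [TopologicalSpace α] {T : α → α} {c d : α} {W C : Set α}

lemma exists_long_stay (hT : Continuous T) (hW : IsOpen W)
    (hd : MapClusterPt d atTop fun n => T^[n] c) (hdW : ∀ i, T^[i] d ∈ W)
    (hcW : ∃ᶠ n in atTop, T^[n] c ∉ W) (n : ℕ) :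
    ∃ e, n ≤ e ∧ T^[e + 1] c ∉ W ∧ ∀ i ≤ n, T^[e - i] c ∈ W := by
  have hev : ∀ᶠ v in 𝓝 d, ∀ i ∈ Iic n, T^[i] v ∈ W :=
    (finite_Iic n).eventually_all.2 fun i _ =>
      (hT.iterate i).continuousAt (hW.mem_nhds (hdW i))
  obtain ⟨m, hm⟩ := (mapClusterPt_iff_frequently.1 hd _ hev).exists
  simp only [mem_ofPred_eq, mem_Iic, ← Function.iterate_add_apply] at hm
  classical
  have hexit : ∃ k, T^[m + k] c ∉ W := by
    obtain ⟨k, hk, hkW⟩ := frequently_atTop.1 hcW m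
    exact ⟨k - m, by rwa [Nat.add_sub_cancel' hk]⟩
  have hn : n < Nat.find hexit := (Nat.lt_find_iff _ _).2 fun i hi => by
    rw [not_not, Nat.add_comm]
    exact hm i hi
  obtain ⟨k, hk⟩ := Nat.exists_eq_add_one_of_ne_zero (Nat.ne_zero_of_lt hn)
  refine ⟨m + k, by omega, ?_, fun i hi => ?_⟩
  · rw [Nat.add_assoc, ← hk]
    exact Nat.find_spec hexit
  · rw [Nat.add_sub_assoc (by omega)]
    exact not_not.1 (Nat.find_min hexit (by omega))

variable [T2Space α]

lemma exists_backward_limit (hT : Continuous T) (hC : IsCompact C) (hc : ∀ n, T^[n] c ∈ C)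
    {e : ℕ → ℕ} (he : Tendsto e atTop atTop) :
    ∃ u : ℕ → α, (∀ i, T (u (i + 1)) = u i) ∧
      ∀ i, Tendsto (fun n => T^[e n - i] c) (hyperfilter ℕ) (𝓝 (u i)) := by
  have hlim (i : ℕ) : ∃ v, Tendsto (fun n => T^[e n - i] c) (hyperfilter ℕ) (𝓝 v) := by
    obtain ⟨v, -, hv⟩ := hC.ultrafilter_le_nhds' ((hyperfilter ℕ).map fun n => T^[e n - i] c)
      (Ultrafilter.mem_map.2 (univ_mem' fun n => hc (e n - i)))
    exact ⟨v, hv⟩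
  choose u hu using hlim
  refine ⟨u, fun i => tendsto_nhds_unique ((hT.tendsto _).comp (hu (i + 1))) ?_, hu⟩
  refine (hu i).congr' (Nat.hyperfilter_le_atTop ((he.eventually_gt_atTop i).mono fun n hn => ?_))
  change T^[e n - i] c = T (T^[e n - (i + 1)] c)
  rw [← Function.iterate_succ_apply' T, Nat.succ_eq_add_one, ← Nat.sub_sub,
    Nat.sub_add_cancel (Nat.sub_pos_of_lt hn)]

lemma exists_backward_orbit_leaving (hT : Continuous T) (hC : IsCompact C)
    (hc : ∀ n, T^[n] c ∈ C) (hW : IsOpen W) (hd : MapClusterPt d atTop fun n => T^[n] c)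
    (hdW : ∀ i, T^[i] d ∈ W) (hcW : ∃ᶠ n in atTop, T^[n] c ∉ W) :
    ∃ u : ℕ → α, (∀ i, T (u (i + 1)) = u i) ∧
      (∀ i, MapClusterPt (u i) atTop fun n => T^[n] c) ∧ (∀ i, u i ∈ closure W) ∧
      T (u 0) ∉ W := by
  choose e hne heW hestay using exists_long_stay hT hW hd hdW hcW
  have he : Tendsto e atTop atTop := tendsto_atTop_mono hne tendsto_id
  obtain ⟨u, hTu, hu⟩ := exists_backward_limit hT hC hc he
  refine ⟨u, hTu, fun i => ?_, fun i => ?_, ?_⟩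
  · exact (hu i).mapClusterPt.of_comp
      (((tendsto_sub_atTop_nat i).comp he).mono_left Nat.hyperfilter_le_atTop)
  · exact mem_closure_of_tendsto (hu i)
      (Nat.hyperfilter_le_atTop ((eventually_ge_atTop i).mono fun n hn => hestay n i hn))
  · refine hW.isClosed_compl.mem_of_tendsto ((hT.tendsto _).comp (hu 0))
      (Eventually.of_forall fun n => ?_)
    change T (T^[e n] c) ∉ W
    rw [← Function.iterate_succ_apply' T]
    exact heW n

end Leaving

/-! ### The inverse limit of the omega-limit set -/

section Omega

variable {s y : ℝ} {x : ℕ → ℝ}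

lemma mem_omegaCrit : y ∈ omegaCrit s ↔ MapClusterPt y atTop (critOrbit s) := by
  rw [omegaCrit, mem_omegaLimit_singleton_iff_mapClusterPt]
  rfl

lemma isClosed_omegaCrit (s : ℝ) : IsClosed (omegaCrit s) := isClosed_omegaLimit _ _ _

lemma mapsTo_tent_omegaCrit (s : ℝ) : MapsTo (tent s) (omegaCrit s) (omegaCrit s) := by
  intro y hy
  rw [mem_omegaCrit] at hy ⊢
  refine MapClusterPt.of_comp (tendsto_add_atTop_nat 1) ?_
  simpa only [Function.comp_def, critOrbit_succ] using
    hy.continuousAt_comp (continuous_tent s).continuousAt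

lemma omegaCrit_subset_of_eventually {C : Set ℝ} (hC : IsClosed C)
    (h : ∀ᶠ n in atTop, critOrbit s n ∈ C) : omegaCrit s ⊆ C :=
  fun _ hy => hC.mem_of_mapClusterPt (mem_omegaCrit.1 hy) h

lemma omegaCrit_subset_core (hs : 1 ≤ s) (hs2 : s ≤ 2) : omegaCrit s ⊆ core s :=
  omegaCrit_subset_of_eventually isClosed_Icc (Eventually.of_forall (critOrbit_mem_core hs hs2))

lemma omegaSpace_subset_coreSpace (hs : 1 ≤ s) (hs2 : s ≤ 2) : omegaSpace s ⊆ coreSpace s :=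
  invLim_mono (omegaCrit_subset_core hs hs2)

lemma omegaSpace_subset_space (hs : 1 ≤ s) (hs2 : s ≤ 2) : omegaSpace s ⊆ space s :=
  invLim_mono ((omegaCrit_subset_core hs hs2).trans (core_subset_Icc hs hs2))

lemma subsingleton_omegaSpace_two : (omegaSpace 2).Subsingleton := by
  have hzero (n : ℕ) : critOrbit 2 (n + 2) = 0 := by
    induction n with
    | zero => rw [critOrbit_two (by norm_num)]; norm_num
    | succ n ih => rw [Nat.succ_add, critOrbit_succ, ih]; norm_num [tent]
  have homega : omegaCrit 2 ⊆ {0} := omegaCrit_subset_of_eventually isClosed_singleton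
    ((eventually_ge_atTop 2).mono fun n hn => by
      obtain ⟨k, rfl⟩ := Nat.exists_eq_add_of_le' hn
      exact hzero k)
  exact fun x hx y hy => funext fun i => (homega (hx.1 i)).trans (homega (hy.1 i)).symm

lemma shift_mem_omegaSpace_sdiff (hs : 1 ≤ s) (hs2 : s ≤ 2)
    (hx : x ∈ omegaSpace s \ endpoints (space s)) :
    shift (tent s) x ∈ omegaSpace s \ endpoints (space s) :=
  ⟨mapsTo_shift (mapsTo_tent_omegaCrit s) hx.1, fun h => hx.2 <|
    mem_endpoints_of_apply_mem (continuous_shift (continuous_tent s)) injective_shift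
      (mapsTo_shift (mapsTo_tent_unitInterval (by linarith) hs2))
      (omegaSpace_subset_space hs hs2 hx.1) h⟩

lemma notMem_endpoints_of_mem_omegaSpace {C : Set ℝ} (hs : 1 ≤ s) (hs2 : s < 2)
    (hC : IsClosed C) (hcrit : crit ∉ C ∩ omegaCrit s) (hx : x ∈ omegaSpace s)
    (hxC : ∀ i, x i ∈ C) : x ∉ endpoints (space s) := by
  have hsub := omegaCrit_subset_core hs hs2.le
  have hCcore : C ∩ omegaCrit s ⊆ core s := inter_subset_right.trans hsub
  refine notMem_endpoints_of_forall_mem hs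
    (isCompact_Icc.of_isClosed_subset (hC.inter (isClosed_omegaCrit s)) hCcore)
    (fun y hy => ⟨?_, fun h => hcrit (h ▸ hy)⟩) (omegaSpace_subset_space hs hs2.le hx)
    fun i => ⟨hxC i, hx.1 i⟩
  have hy := hCcore hy
  rw [core, critOrbit_two hs, critOrbit_one (by linarith)] at hy
  constructor <;> nlinarith [hy.1, hy.2]

/-- The coordinates of the non-endpoints of the inverse limit of `ω(c)`. Since `endpoints` is
invariant under the shift, it does not matter which coordinate is taken. -/
def innerProj (s : ℝ) : Set ℝ := (· 0) '' (omegaSpace s \ endpoints (space s))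

lemma mapsTo_tent_innerProj (hs : 1 ≤ s) (hs2 : s ≤ 2) :
    MapsTo (tent s) (innerProj s) (innerProj s) := by
  rintro _ ⟨x, hx, rfl⟩
  exact ⟨_, shift_mem_omegaSpace_sdiff hs hs2 hx, rfl⟩

lemma innerProj_subset_image_apply (hs : 1 ≤ s) (hs2 : s ≤ 2) (M : ℕ) :
    innerProj s ⊆ (· M) '' (omegaSpace s \ endpoints (space s)) := by
  rintro _ ⟨x, hx, rfl⟩
  have hmaps : MapsTo (shift (tent s)) (omegaSpace s \ endpoints (space s))
    (omegaSpace s \ endpoints (space s)) := fun _ => shift_mem_omegaSpace_sdiff hs hs2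
  exact ⟨_, hmaps.iterate M hx, iterate_shift_apply_self x M⟩

/-- If the critical point were not approximated by coordinates of non-endpoints, then some orbit
in `ω(c)` would stay near these coordinates in the past, and therefore be a non-endpoint, but
leave their neighbourhood in the next step. -/
lemma crit_mem_closure_innerProj (hs : 1 ≤ s) (hs2 : s < 2) (hcrit : crit ∈ omegaCrit s)
    (hne : (innerProj s).Nonempty) : crit ∈ closure (innerProj s) := by
  by_contra hcl
  obtain ⟨W, hW, hDW, hWc⟩ := normal_exists_closure_subset isClosed_closure
    isOpen_compl_singleton (subset_compl_singleton_iff.2 hcl)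
  have hcW : crit ∉ closure W := fun h => hWc h rfl
  obtain ⟨_, x, hx, rfl⟩ := hne
  have hinner : ∀ i, (tent s)^[i] (x 0) ∈ innerProj s := fun i =>
    (mapsTo_tent_innerProj hs hs2.le).iterate i ⟨x, hx, rfl⟩
  obtain ⟨u, hTu, huω, huW, hu0⟩ := exists_backward_orbit_leaving (continuous_tent s)
    isCompact_Icc (critOrbit_mem_core hs hs2.le) hW (mem_omegaCrit.1 (hx.1.1 0))
    (fun i => hDW (subset_closure (hinner i)))
    fun h => hcW (omegaCrit_subset_of_eventually isClosed_closure
      (h.mono fun n hn => subset_closure (not_not.1 hn)) hcrit)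
  have hu : u ∈ omegaSpace s := ⟨fun i => mem_omegaCrit.2 (huω i), hTu⟩
  have huE := notMem_endpoints_of_mem_omegaSpace hs hs2 isClosed_closure (fun h => hcW h.1) hu huW
  exact hu0 (hDW (subset_closure (mapsTo_tent_innerProj hs hs2.le ⟨u, ⟨hu, huE⟩, rfl⟩)))

lemma omegaSpace_subset_closure (hs : 1 ≤ s) (hs2 : s < 2)
    (hne : (omegaSpace s \ endpoints (space s)).Nonempty) :
    omegaSpace s ⊆ closure (omegaSpace s \ endpoints (space s)) := by
  by_cases hcrit : crit ∈ omegaCrit s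
  · have hc := crit_mem_closure_innerProj hs hs2 hcrit (hne.image _)
    have horbit (n : ℕ) : critOrbit s n ∈ closure (innerProj s) :=
      ((mapsTo_tent_innerProj hs hs2.le).closure (continuous_tent s)).iterate n hc
    have hω := omegaCrit_subset_of_eventually isClosed_closure (Eventually.of_forall horbit)
    exact fun y hy => mem_closure_of_frequently_apply (continuous_tent s) sdiff_subset hy
      (Eventually.of_forall fun M =>
        closure_mono (innerProj_subset_image_apply hs hs2.le M) (hω (hy.1 M))).frequently
  · exact fun y hy => subset_closure ⟨hy, notMem_endpoints_of_mem_omegaSpace hs hs2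
      (isClosed_omegaCrit s) (fun h => hcrit h.1) hy hy.1⟩

end Omega

/-! ### Folding at the coordinates of the critical point -/

section RightLift

variable {s q : ℝ}

/-- The point of the inverse limit with coordinate `q` at position `N` all of whose later
coordinates lie to the right of the critical point. -/
noncomputable def rightLift (s : ℝ) (N : ℕ) (q : ℝ) : ℕ → ℝ := (shift (tent s))^[N] (follow s 1 q)

lemma follow_one_succ (s q : ℝ) (l : ℕ) : follow s 1 q (l + 1) = 1 - follow s 1 q l / s := by
  rw [follow, if_neg (by norm_num [crit])]

lemma continuous_rightLift (s : ℝ) (N : ℕ) : Continuous (rightLift s N) :=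
  ((continuous_shift (continuous_tent s)).iterate N).comp
    (continuous_follow continuous_const continuous_id fun _ _ => by norm_num [crit])

lemma rightLift_apply_self (s : ℝ) (N : ℕ) (q : ℝ) : rightLift s N q N = q :=
  iterate_shift_apply_self _ N

lemma rightLift_apply_add (s : ℝ) (N l : ℕ) (q : ℝ) : rightLift s N q (N + l) = follow s 1 q l :=
  iterate_shift_apply_add _ N l

lemma rightLift_add_apply (s : ℝ) (N l : ℕ) (q : ℝ) :
    rightLift s (N + l) q N = (tent s)^[l] q := by
  rw [rightLift, iterate_shift_apply_of_le _ (Nat.le_add_right N l), Nat.add_sub_cancel_left]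
  rfl

lemma follow_one_mem_core (hs : 1 ≤ s) (hq : q ∈ core s) (l : ℕ) : follow s 1 q l ∈ core s := by
  have hs0 : 0 < s := by linarith
  induction l with
  | zero => exact hq
  | succ l ih =>
    rw [follow_one_succ]
    have hlow : 1 - s / 2 ≤ follow s 1 q l / s := by
      rw [le_div_iff₀ hs0, mul_comm, ← critOrbit_two hs]
      exact ih.1
    have hhigh := div_le_crit hs0 ih.2
    have hc := critOrbit_two_le_crit hs
    constructor
    · unfold crit at hc hhigh; linarith
    · rw [critOrbit_one hs0.le]; linarith

lemma rightLift_mem_coreSpace (hs : 1 ≤ s) (hs2 : s ≤ 2) (N : ℕ) (hq : q ∈ core s) :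
    rightLift s N q ∈ coreSpace s :=
  (mapsTo_shift (mapsTo_tent_core hs hs2)).iterate N <| follow_mem_invLim (by linarith)
    (follow_one_mem_core hs hq) fun l => (follow_one_mem_core hs hq l).2

end RightLift

lemma subset_or_subset_of_isGreatest {α : Type*} [LinearOrder α] {A B : Set α} {m : α}
    (hA : A.OrdConnected) (hB : B.OrdConnected) (hAm : IsGreatest A m) (hBm : IsGreatest B m) :
    A ⊆ B ∨ B ⊆ A := by
  by_contra! h
  obtain ⟨⟨p, hpA, hpB⟩, ⟨q, hqB, hqA⟩⟩ := h.imp not_subset.1 not_subset.1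
  rcases le_total p q with hpq | hqp
  · exact hqA (hA.out hpA hAm.1 ⟨hpq, hBm.2 hqB⟩)
  · exact hpB (hB.out hqB hBm.1 ⟨hqp, hAm.2 hpA⟩)

lemma nonempty_homeomorph_real {a b : ℝ} (hab : a < b) : Nonempty (Ioo a b ≃ₜ ℝ) := by
  have hπ := Real.pi_pos
  have hslope : 0 < (b - a) / Real.pi := div_pos (sub_pos.2 hab) hπ
  have himage : affineHomeomorph ((b - a) / Real.pi) ((a + b) / 2) hslope.ne' ''
      Ioo (-(Real.pi / 2)) (Real.pi / 2) = Ioo a b := by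
    rw [affineHomeomorph_image_Ioo _ _ _ _ hslope]
    congr 1 <;> field_simp <;> ring
  exact ⟨(((affineHomeomorph _ _ hslope.ne').image _).trans
    (Homeomorph.setCongr himage)).symm.trans Real.tanOrderIso.toHomeomorph⟩

section Folding

variable {T : ℝ → ℝ} {S : Set ℝ} {x y : ℕ → ℝ} {c : ℝ}

lemma eventually_apply_notMem_image {R : Set (ℕ → ℝ)} (hT : Continuous T) (hRc : IsCompact R)
    (hR : R ⊆ invLim T S) (hy : y ∈ invLim T S) (hyR : y ∉ R) :
    ∀ᶠ M in atTop, y M ∉ (· M) '' R := by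
  by_contra h
  refine hyR (hRc.isClosed.closure_subset (mem_closure_of_frequently_apply hT hR hy ?_))
  exact (not_eventually.1 h).mono fun M hM => subset_closure (not_not.1 hM)

lemma eventually_exists_mem_of_mem_nhdsWithin {E : Type*} [TopologicalSpace E] {U Y : Set E} {x : E}
    (hU : U ∈ 𝓝[Y] x) (hxU : x ∈ U) {P : U → Prop} (hP : ∀ᶠ u in 𝓝 ⟨x, hxU⟩, P u) :
    ∀ᶠ y in 𝓝[Y] x, ∃ h : y ∈ U, P ⟨y, h⟩ := by
  refine (nhdsWithin_le_of_mem hU) ?_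
  rw [nhdsWithin_eq_map_subtype_coe hxU, mem_map]
  exact hP.mono fun u hu => ⟨u.2, hu⟩

lemma exists_apply_eq_of_apply_max {γ : ℝ → ℕ → ℝ} {a τ b : ℝ} {N j : ℕ} (hγ : Continuous γ)
    (hmem : ∀ σ, γ σ ∈ invLim T S) (hmax : ∀ u ∈ S, T u ≤ T c) (hτ : τ ∈ Icc a b) (hNj : N ≤ j)
    (hcrit : γ τ (j + 1) = c) :
    (∃ σ ∈ Icc τ b, γ σ N = γ a N) ∨ ∃ σ ∈ Icc a τ, γ σ N = γ b N := by
  have hproj : ∀ ⦃σ ρ⦄, γ σ j = γ ρ j → γ σ N = γ ρ N := fun σ ρ h => by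
    rw [← iterate_sub_apply_of_mem_invLim (hmem σ) hNj, h,
      iterate_sub_apply_of_mem_invLim (hmem ρ) hNj]
  have hord : ∀ u v, OrdConnected ((γ · j) '' Icc u v) := fun u v =>
    (isPreconnected_Icc.image _ ((continuous_apply j).comp hγ).continuousOn).ordConnected
  have hgreatest : ∀ ⦃u v⦄, τ ∈ Icc u v → IsGreatest ((γ · j) '' Icc u v) (γ τ j) := by
    refine fun u v h => ⟨mem_image_of_mem _ h, ?_⟩
    rintro _ ⟨σ, -, rfl⟩
    change γ σ j ≤ γ τ j
    rw [← (hmem σ).2 j, ← (hmem τ).2 j, hcrit]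
    exact hmax _ ((hmem σ).1 (j + 1))
  rcases subset_or_subset_of_isGreatest (hord a τ) (hord τ b) (hgreatest (right_mem_Icc.2 hτ.1))
    (hgreatest (left_mem_Icc.2 hτ.2)) with h | h
  · obtain ⟨σ, hσ, h⟩ := h (mem_image_of_mem _ (left_mem_Icc.2 hτ.1))
    exact Or.inl ⟨σ, hσ, hproj h⟩
  · obtain ⟨σ, hσ, h⟩ := h (mem_image_of_mem _ (right_mem_Icc.2 hτ.2))
    exact Or.inr ⟨σ, hσ, hproj h⟩

lemma eventually_eventually_forall_apply_ne {K : Type*} [TopologicalSpace K]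
    {g : K → ℝ → ℕ → ℝ} (hT : Continuous T) (hg : Continuous (Function.uncurry g))
    (hmem : ∀ κ τ, g κ τ ∈ invLim T S) {k : K} (hinj : Function.Injective (g k)) {u p q : ℝ}
    (hu : u ∉ Icc p q) :
    ∀ᶠ N in atTop, ∀ᶠ κ in 𝓝 k, ∀ τ ∈ Icc p q, g κ τ N ≠ g κ u N := by
  have harc : IsCompact (g k '' Icc p q) :=
    isCompact_Icc.image (hg.comp (Continuous.prodMk_right k))
  filter_upwards [eventually_apply_notMem_image hT harc (image_subset_iff.2 fun τ _ => hmem k τ)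
    (hmem k u) (hinj.mem_set_image.not.2 hu)] with N hN
  refine isCompact_Icc.eventually_forall_of_forall_eventually fun τ hτ => ?_
  have hgN := (continuous_apply N).comp hg
  have hgu : Continuous fun z : K × ℝ => g z.1 u N :=
    hgN.comp (continuous_fst.prodMk continuous_const)
  exact (isOpen_ne_fun hgN hgu).mem_nhds fun h => hN ⟨_, mem_image_of_mem _ hτ, h⟩

/-- In a product chart around `x`, no end of an arc through a point near `x` has a coordinate `N`
that is met again beyond the middle of the arc. But an arc through a point whose coordinate `j + 1`
is the turning point `c` folds there: the coordinate `j` along one half covers the other half. -/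
lemma not_hasCantorArcNhd_of_mem_closure (hT : Continuous T) (hmax : ∀ u ∈ S, T u ≤ T c)
    (hx : x ∈ invLim T S)
    (hcl : ∀ N, x ∈ closure {z ∈ invLim T S | ∃ j, N ≤ j ∧ z (j + 1) = c}) :
    ¬ HasCantorArcNhd (invLim T S) x := by
  rintro ⟨U, hUY, hU, K, -, ⟨φ'⟩⟩
  obtain ⟨e⟩ := nonempty_homeomorph_real zero_lt_one
  obtain ⟨φ⟩ : Nonempty (U ≃ₜ K × ℝ) := ⟨φ'.trans ((Homeomorph.refl K).prodCongr e)⟩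
  have hxU := mem_of_mem_nhdsWithin hx hU
  set k := (φ ⟨x, hxU⟩).1
  set t := (φ ⟨x, hxU⟩).2
  set g : K → ℝ → ℕ → ℝ := fun κ τ => φ.symm (κ, τ)
  have hgY : ∀ κ τ, g κ τ ∈ invLim T S := fun κ τ => hUY (φ.symm (κ, τ)).2
  have hginj : Function.Injective (g k) := fun σ τ h =>
    congrArg Prod.snd (φ.symm.injective (Subtype.ext h))
  have hg : Continuous (Function.uncurry g) := continuous_subtype_val.comp φ.symm.continuous
  obtain ⟨N, hleft, hright⟩ :=
    ((eventually_eventually_forall_apply_ne (u := t - 2) (p := t - 1) (q := t + 2)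
      hT hg hgY hginj fun h => by linarith [h.1]).and
    (eventually_eventually_forall_apply_ne (u := t + 2) (p := t - 2) (q := t + 1)
      hT hg hgY hginj fun h => by linarith [h.2])).exists
  have hmid : ∀ᶠ τ in 𝓝 t, τ ∈ Ioo (t - 1) (t + 1) :=
    Ioo_mem_nhds (by linarith) (by linarith)
  have hbox := eventually_exists_mem_of_mem_nhdsWithin hU hxU
    (φ.continuous.continuousAt.eventually ((hleft.and hright).prod_nhds hmid))
  obtain ⟨z, ⟨hzY, j, hNj, hzj⟩, hz⟩ := ((mem_closure_iff_frequently.1 (hcl N)).and_eventually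
    (eventually_nhdsWithin_iff.1 hbox)).exists
  obtain ⟨hzU, ⟨hl, hr⟩, hτ⟩ := hz hzY
  have hgz : g (φ ⟨z, hzU⟩).1 (φ ⟨z, hzU⟩).2 = z := congrArg Subtype.val (φ.symm_apply_apply _)
  generalize φ ⟨z, hzU⟩ = w at hgz hl hr hτ
  rcases exists_apply_eq_of_apply_max (a := t - 2) (b := t + 2)
    (hg.comp (Continuous.prodMk_right _)) (hgY _) hmax ⟨by linarith [hτ.1], by linarith [hτ.2]⟩
    hNj (hgz ▸ hzj) with ⟨σ, hσ, h⟩ | ⟨σ, hσ, h⟩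
  · exact hl σ ⟨by linarith [hτ.1, hσ.1], hσ.2⟩ h
  · exact hr σ ⟨hσ.1, by linarith [hτ.2, hσ.2]⟩ h

end Folding

lemma omegaSpace_subset_foldingPoints {s : ℝ} (hs : 1 ≤ s) (hs2 : s ≤ 2) :
    omegaSpace s ⊆ foldingPoints s := by
  intro x hx
  have hxc := omegaSpace_subset_coreSpace hs hs2 hx
  have hs0 : 0 ≤ s := by linarith
  refine ⟨hxc, not_hasCantorArcNhd_of_mem_closure (continuous_tent s)
    (fun u _ => (tent_le_critOrbit_one hs0 u).trans_eq (critOrbit_succ s 0)) hxc fun N => ?_⟩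
  refine mem_closure_of_frequently_apply (continuous_tent s) (fun z hz => hz.1) hx
    ((eventually_gt_atTop N).mono fun M hM => ?_).frequently
  refine omegaCrit_subset_of_eventually isClosed_closure
    (Eventually.of_forall fun m => subset_closure ?_) (hx.1 M)
  refine ⟨rightLift s (M + m) crit,
    ⟨rightLift_mem_coreSpace hs hs2 _ (critOrbit_mem_core hs hs2 0), M + m - 1, by omega, ?_⟩,
    rightLift_add_apply s M m crit⟩
  rw [Nat.sub_add_cancel (by omega)]
  exact rightLift_apply_self s (M + m) crit

/-! ### Product structure away from the critical orbit -/

lemma subset_Ioo_of_ordConnected {α : Type*} [LinearOrder α] {J : Set α} {a b : α}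
    (hJ : J.OrdConnected) (hne : (J ∩ Icc a b).Nonempty) (ha : a ∉ J) (hb : b ∉ J) :
    J ⊆ Ioo a b := by
  obtain ⟨u, huJ, hau, hub⟩ := hne
  exact fun v hv => ⟨not_le.1 fun h => ha (hJ.out hv huJ ⟨h, hau⟩),
    not_le.1 fun h => hb (hJ.out huJ hv ⟨hub, h⟩)⟩

lemma iterate_tent_critOrbit (s : ℝ) (n k : ℕ) :
    (tent s)^[n] (critOrbit s k) = critOrbit s (n + k) :=
  (Function.iterate_add_apply _ _ _ _).symm

section Product

variable {s t : ℝ} {y : ℕ → ℝ} {S I : Set ℝ} {l N : ℕ}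

lemma apply_ne_critOrbit (hI : ∀ k, critOrbit s k ∉ I) (hy : y ∈ invLim (tent s) S)
    (hyN : y N ∈ I) (l k : ℕ) : y (N + l) ≠ critOrbit s k := by
  intro h
  rw [← iterate_apply_of_mem_invLim hy N l, h, iterate_tent_critOrbit] at hyN
  exact hI _ hyN

lemma follow_succ_le_crit_iff (hs : 0 < s) (h : follow s y t l < critOrbit s 1) :
    follow s y t (l + 1) ≤ crit ↔ y (l + 1) ≤ crit := by
  rw [critOrbit_one hs.le] at h
  have hdiv : follow s y t l / s < crit := by rw [div_lt_iff₀ hs, crit]; linarith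
  rw [follow]
  split_ifs with hy
  · exact iff_of_true hdiv.le hy
  · exact iff_of_false (by unfold crit at *; linarith) hy

lemma iterate_tent_follow (hs : 0 < s) (h : ∀ m < l, follow s y t m ≤ critOrbit s 1) :
    (tent s)^[l] (follow s y t l) = t := by
  induction l with
  | zero => rfl
  | succ l ih =>
    rw [Function.iterate_succ_apply, tent_follow_succ hs (h l l.lt_succ_self),
      ih fun m hm => h m (hm.trans l.lt_succ_self)]

/-- The coordinate `l` of the orbits that follow `y` runs through an interval which avoids the
critical orbit together with `I`, so it cannot leave the core. -/
lemma mapsTo_follow (hs : 0 < s) (hIc : I.OrdConnected) (hI : ∀ k, critOrbit s k ∉ I)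
    (hy : y ∈ coreSpace s) (hy0 : y 0 ∈ I) (l : ℕ) :
    MapsTo (follow s y · l) I (Ioo (critOrbit s 2) (critOrbit s 1)) := by
  induction l using Nat.strong_induction_on with
  | _ l ih =>
    have hcont : Continuous (follow s y · l) := (continuous_apply l).comp <|
      continuous_follow continuous_const continuous_id fun _ m h =>
        apply_ne_critOrbit hI hy hy0 (m + 1) 0 ((congrArg y (Nat.zero_add _)).trans h)
    have havoid (k : ℕ) : critOrbit s k ∉ (follow s y · l) '' I := by
      rintro ⟨t, ht, h⟩
      change follow s y t l = critOrbit s k at h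
      rw [← iterate_tent_follow hs fun m hm => (ih m hm ht).2.le, h, iterate_tent_critOrbit] at ht
      exact hI _ ht
    refine mapsTo_iff_image_subset.2 (subset_Ioo_of_ordConnected
      (hIc.isPreconnected.image _ hcont.continuousOn).ordConnected
      ⟨_, mem_image_of_mem _ hy0, ?_⟩ (havoid 2) (havoid 1))
    rw [follow_self hs hy]
    exact hy.1 l

/-- The backward orbit with coordinate `t` at position `N` along the inverse branches of `y`. -/
noncomputable def slide (s : ℝ) (N : ℕ) (y : ℕ → ℝ) (t : ℝ) : ℕ → ℝ :=
  (shift (tent s))^[N] (follow s (fun l => y (N + l)) t)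

lemma slide_apply_self (s : ℝ) (N : ℕ) (y : ℕ → ℝ) (t : ℝ) : slide s N y t N = t :=
  iterate_shift_apply_self _ N

lemma slide_self (hs : 0 < s) (hy : y ∈ invLim (tent s) S) (ht : y N = t) :
    slide s N y t = y := by
  subst ht
  exact (congrArg _ (follow_self hs (drop_mem_invLim hy N))).trans (iterate_shift_drop hy N)

lemma slide_mem_coreSpace (hs : 1 ≤ s) (hs2 : s ≤ 2) (hIc : I.OrdConnected)
    (hI : ∀ k, critOrbit s k ∉ I) (hy : y ∈ coreSpace s) (hyN : y N ∈ I) (ht : t ∈ I) :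
    slide s N y t ∈ coreSpace s := by
  have hs0 : 0 < s := by linarith
  have h := mapsTo_follow hs0 hIc hI (drop_mem_invLim hy N) hyN
  exact (mapsTo_shift (mapsTo_tent_core hs hs2)).iterate N
    (follow_mem_invLim hs0 (fun l => Ioo_subset_Icc_self (h l ht)) fun l => (h l ht).2.le)

lemma slide_slide (hs : 0 < s) (hIc : I.OrdConnected) (hI : ∀ k, critOrbit s k ∉ I)
    (hy : y ∈ coreSpace s) (hyN : y N ∈ I) (ht : t ∈ I) (t' : ℝ) :
    slide s N (slide s N y t) t' = slide s N y t' := by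
  refine congrArg _ (follow_congr fun l => ?_)
  rw [slide, iterate_shift_apply_add]
  exact follow_succ_le_crit_iff hs (mapsTo_follow hs hIc hI (drop_mem_invLim hy N) hyN l ht).2

/-- The part of the core inverse limit with coordinate in `I` at position `N`. -/
def box (s : ℝ) (N : ℕ) (I : Set ℝ) : Set (ℕ → ℝ) := {y ∈ coreSpace s | y N ∈ I}

lemma continuous_slide {Z : Type*} [TopologicalSpace Z] {y : Z → ℕ → ℝ} {t : Z → ℝ}
    (hI : ∀ k, critOrbit s k ∉ I) (hy : Continuous y) (hbox : ∀ z, y z ∈ box s N I)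
    (ht : Continuous t) : Continuous fun z => slide s N (y z) (t z) :=
  ((continuous_shift (continuous_tent s)).iterate N).comp <| continuous_follow
    (continuous_pi fun _ => (continuous_apply _).comp hy) ht fun z l =>
      apply_ne_critOrbit hI (hbox z).1 (hbox z).2 (l + 1) 0

/-- Over an interval `I` free of the critical orbit the core inverse limit is the product of `I`
with the fibre over any `p ∈ I`. -/
noncomputable def boxHomeomorph (hs : 1 ≤ s) (hs2 : s ≤ 2) (N : ℕ) (hIc : I.OrdConnected)
    (hI : ∀ k, critOrbit s k ∉ I) {p : ℝ} (hp : p ∈ I) :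
    box s N I ≃ₜ ({y ∈ coreSpace s | y N = p} : Set (ℕ → ℝ)) × I where
  toFun y := (⟨slide s N y p, slide_mem_coreSpace hs hs2 hIc hI y.2.1 y.2.2 hp,
    slide_apply_self s N y p⟩, ⟨(y : ℕ → ℝ) N, y.2.2⟩)
  invFun q := ⟨slide s N q.1 q.2, slide_mem_coreSpace hs hs2 hIc hI q.1.2.1
    (mem_of_eq_of_mem q.1.2.2 hp) q.2.2, mem_of_eq_of_mem (slide_apply_self s N q.1 q.2) q.2.2⟩
  left_inv y := Subtype.ext <|
    (slide_slide (by linarith) hIc hI y.2.1 y.2.2 hp _).trans (slide_self (by linarith) y.2.1 rfl)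
  right_inv q := Prod.ext (Subtype.ext <|
    (slide_slide (by linarith) hIc hI q.1.2.1 (mem_of_eq_of_mem q.1.2.2 hp) q.2.2 p).trans
      (slide_self (by linarith) q.1.2.1 q.1.2.2)) (Subtype.ext (slide_apply_self s N q.1 q.2))
  continuous_toFun := ((continuous_slide hI continuous_subtype_val (fun y => y.2)
    continuous_const).subtype_mk _).prodMk
      (((continuous_apply N).comp continuous_subtype_val).subtype_mk _)
  continuous_invFun := (continuous_slide hI (continuous_subtype_val.comp continuous_fst)
    (fun q => ⟨q.1.2.1, mem_of_eq_of_mem q.1.2.2 hp⟩)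
    (continuous_subtype_val.comp continuous_snd)).subtype_mk _

end Product

/-! ### Cantor fibres -/

/-- The fixed point of the tent map to the right of the critical point. -/
noncomputable def fixedPt (s : ℝ) : ℝ := s / (1 + s)

section CantorFibre

variable {s p q u : ℝ} {x : ℕ → ℝ}

lemma one_sub_fixedPt_div (hs : 0 < s) : 1 - fixedPt s / s = fixedPt s := by
  unfold fixedPt; field_simp; ring

lemma fixedPt_lt_critOrbit_three_iff (hs : 1 < s) : fixedPt s < critOrbit s 3 ↔ s ^ 2 < 2 := by
  have hfactor : critOrbit s 3 - fixedPt s = s * (s - 1) * (2 - s ^ 2) / (2 * (1 + s)) := by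
    rw [critOrbit_three hs.le, critOrbit_two hs.le, fixedPt]; field_simp; ring
  have hpos : 0 < s * (s - 1) := mul_pos (by linarith) (by linarith)
  rw [← sub_pos, hfactor, div_pos_iff_of_pos_right (by linarith), mul_pos_iff_of_pos_left hpos,
    sub_pos]

lemma crit_lt_of_tent_lt_critOrbit_three (hs : 1 ≤ s) (hu : critOrbit s 2 ≤ u)
    (h : tent s u < critOrbit s 3) : crit < u := by
  by_contra! hle
  rw [tent_of_le_crit (by linarith) hle, critOrbit_three hs] at h
  nlinarith

lemma frequently_critOrbit_three_le (hs : 1 < s) (h2 : 2 ≤ s ^ 2) (hx : x ∈ coreSpace s) :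
    ∃ᶠ n in atTop, critOrbit s 3 ≤ x n := by
  refine frequently_atTop.2 fun N => ?_
  rcases le_or_gt (critOrbit s 3) (x N) with h | h
  · exact ⟨N, le_rfl, h⟩
  have hs0 : 0 < s := by linarith
  have hfix : critOrbit s 3 ≤ fixedPt s :=
    not_lt.1 ((fixedPt_lt_critOrbit_three_iff hs).not.2 h2.not_gt)
  have hright : crit < x (N + 1) :=
    crit_lt_of_tent_lt_critOrbit_three hs.le (hx.1 (N + 1)).1 ((hx.2 N).trans_lt h)
  refine ⟨N + 1, N.le_succ, ?_⟩
  calc critOrbit s 3 ≤ fixedPt s := hfix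
    _ = 1 - fixedPt s / s := (one_sub_fixedPt_div hs0).symm
    _ ≤ 1 - x N / s := by gcongr; linarith
    _ = x (N + 1) := (eq_one_sub_div_of_tent_eq hs0 hright.le (hx.2 N)).symm

lemma exists_tent_eq_and_ne (hs : 1 ≤ s) (hs2 : s ≤ 2)
    (hq : q ∈ Ico (critOrbit s 3) (critOrbit s 1)) (u : ℝ) :
    ∃ v ∈ core s, tent s v = q ∧ v ≠ u := by
  have hs0 : 0 < s := by linarith
  have hqcore : q ∈ core s := ⟨(critOrbit_mem_core hs hs2 3).1.trans hq.1, hq.2.le⟩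
  by_cases hu : follow s 1 q 1 = u
  · have hdiv : q / s < crit := by
      rw [div_lt_iff₀ hs0, crit]
      linarith [hq.2.trans_eq (critOrbit_one hs0.le)]
    refine ⟨q / s, ⟨?_, hdiv.le.trans (critOrbit_mem_core hs hs2 0).2⟩, ?_, ?_⟩
    · rw [le_div_iff₀ hs0, mul_comm, ← critOrbit_three hs]
      exact hq.1
    · rw [tent_of_le_crit hs0.le hdiv.le, mul_div_cancel₀ _ hs0.ne']
    · rw [← hu, follow_one_succ, follow]
      unfold crit at hdiv
      linarith
  · exact ⟨_, follow_one_mem_core hs hqcore 1, tent_follow_succ hs0 hqcore.2, hu⟩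

lemma isCantor_fibre (hs : 1 < s) (hs2 : s ≤ 2) (h2 : 2 ≤ s ^ 2) {N : ℕ} (hp : p ∈ core s)
    (hav : ∀ k, critOrbit s k ≠ p) : IsCantor {y ∈ coreSpace s | y N = p} := by
  have hcomp : IsCompact {y ∈ coreSpace s | y N = p} :=
    (isCompact_invLim (continuous_tent s) isCompact_Icc).inter_right
      (isClosed_eq (continuous_apply N) continuous_const)
  refine ⟨⟨rightLift s N p, rightLift_mem_coreSpace hs.le hs2 N hp, rightLift_apply_self s N p⟩,
    hcomp, ⟨hcomp.isClosed, fun k hk => ?_⟩,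
    isTotallyDisconnected_fibre (finite_tent_preimage (by linarith)) N p⟩
  rw [accPt_principal_iff_clusterPt, ← mem_closure_iff_clusterPt]
  refine mem_closure_of_frequently_apply (continuous_tent s) (fun y hy => hy.1.1) hk.1
    (((frequently_critOrbit_three_le hs h2 hk.1).and_eventually (eventually_ge_atTop N)).mono
      fun n ⟨hn, hNn⟩ => subset_closure ?_)
  obtain ⟨l, rfl⟩ := Nat.exists_eq_add_of_le hNn
  have hne := apply_ne_critOrbit (I := {p}) hav hk.1 hk.2 l 1
  obtain ⟨v, hv, hvk, hvne⟩ := exists_tent_eq_and_ne hs.le hs2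
    ⟨hn, (hk.1.1 (N + l)).2.lt_of_ne hne⟩ (k (N + l + 1))
  have hmem := rightLift_mem_coreSpace hs.le hs2 (N + l + 1) hv
  have hbranch : rightLift s (N + l + 1) v (N + l) = k (N + l) :=
    (rightLift_add_apply s (N + l) 1 v).trans hvk
  refine ⟨_, ⟨⟨hmem, ?_⟩, fun h => hvne ?_⟩, hbranch⟩
  · rw [← iterate_apply_of_mem_invLim hmem N l, hbranch, iterate_apply_of_mem_invLim hk.1, hk.2]
  · rw [← congrFun h (N + l + 1), rightLift_apply_self]

lemma exists_interval_avoiding_critOrbit (hx : x ∈ coreSpace s) (hxω : x ∉ omegaSpace s) :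
    ∃ N a b, x N ∈ Ioo a b ∧ ∀ k, critOrbit s k ∉ Ioo a b := by
  obtain ⟨n, hn⟩ : ∃ n, x n ∉ omegaCrit s := by
    by_contra! h
    exact hxω ⟨h, hx.2⟩
  rw [mem_omegaCrit, mapClusterPt_iff_frequently] at hn
  push Not at hn
  obtain ⟨V, hV, hVk⟩ := hn
  obtain ⟨m, hm⟩ := eventually_atTop.1 hVk
  have hpre : (tent s)^[m] ⁻¹' V ∈ 𝓝 (x (n + m)) := by
    refine ((continuous_tent s).iterate m).continuousAt ?_
    rwa [iterate_apply_of_mem_invLim hx]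
  obtain ⟨a, b, hab, hsub⟩ := mem_nhds_iff_exists_Ioo_subset.1 hpre
  refine ⟨n + m, a, b, hab, fun k hk => hm (m + k) (Nat.le_add_right m k) ?_⟩
  rw [← iterate_tent_critOrbit]
  exact hsub hk

lemma foldingPoints_subset_omegaSpace (hs : 1 < s) (hs2 : s ≤ 2) (h2 : 2 ≤ s ^ 2) :
    foldingPoints s ⊆ omegaSpace s := by
  rintro x ⟨hx, hxF⟩
  by_contra hxω
  obtain ⟨N, a, b, hxI, hI⟩ := exists_interval_avoiding_critOrbit hx hxω
  obtain ⟨e⟩ := nonempty_homeomorph_real (hxI.1.trans hxI.2)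
  obtain ⟨e'⟩ := nonempty_homeomorph_real zero_lt_one
  refine hxF ⟨box s N (Ioo a b), fun y hy => hy.1,
    inter_mem_nhdsWithin _ ((continuous_apply N).continuousAt (isOpen_Ioo.mem_nhds hxI)),
    {y ∈ coreSpace s | y N = x N}, isCantor_fibre hs hs2 h2 (hx.1 N) fun k hk =>
      hI k (mem_of_eq_of_mem hk hxI), ⟨?_⟩⟩
  exact (boxHomeomorph hs.le hs2 N ordConnected_Ioo hI hxI).trans
    ((Homeomorph.refl _).prodCongr (e.trans e'.symm))

end CantorFibre

/-! ### The renormalizable case -/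

section LocallyConnected

variable {X E K : Type*} [TopologicalSpace X] [TopologicalSpace E] [TopologicalSpace K]
  [LocallyConnectedSpace X]

lemma eventually_apply_eq_apply [TotallyDisconnectedSpace K] {g : X → K} (hg : Continuous g)
    (a : X) : ∀ᶠ b in 𝓝 a, g b = g a := by
  filter_upwards [isOpen_connectedComponent.mem_nhds mem_connectedComponent] with b hb
  exact (hg.image_connectedComponent_eq_singleton a).subset (mem_image_of_mem g hb)

/-- In a product chart the Cantor coordinate would be constant near `x`, isolating a point of the
Cantor set. -/
lemma not_hasCantorArcNhd_of_nhdsWithin_eq_map {Y : Set E} {x : E} {f : X → E} {a : X}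
    (hf : Continuous f) (hx : x ∈ Y) (h : 𝓝[Y] x = map f (𝓝 a)) : ¬ HasCantorArcNhd Y x := by
  rintro ⟨U, hUY, hU, K, hK, ⟨φ⟩⟩
  have hxU := mem_of_mem_nhdsWithin hx hU
  obtain ⟨O, hOU, hO, haO⟩ := mem_nhds_iff.1 (mem_map.1 (h ▸ hU))
  have := totallyDisconnectedSpace_subtype_iff.2 hK.2.2.2
  have := hO.locallyConnectedSpace
  obtain ⟨k₀, hk₀⟩ : ∃ k₀, ∀ᶠ y in 𝓝[Y] x, ∀ hy : y ∈ U, (φ ⟨y, hy⟩).1 = k₀ := by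
    have hcont : Continuous fun b : O => (φ ⟨f b, hOU b.2⟩).1 := by fun_prop
    refine ⟨(φ ⟨f a, hOU haO⟩).1, ?_⟩
    rw [h, eventually_map, ← hO.nhdsWithin_eq haO]
    exact (eventually_nhds_subtype_iff O ⟨a, haO⟩ _).1
      ((eventually_apply_eq_apply hcont ⟨a, haO⟩).mono fun b hb _ => hb)
  set k := (φ ⟨x, hxU⟩).1 with hk
  have hslice : Tendsto (fun κ : K => (φ.symm (κ, (φ ⟨x, hxU⟩).2) : E)) (𝓝 k) (𝓝[Y] x) := by
    refine tendsto_nhdsWithin_iff.2 ⟨?_, Eventually.of_forall fun κ => hUY (φ.symm _).2⟩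
    have hcont : Continuous fun κ : K => (φ.symm (κ, (φ ⟨x, hxU⟩).2) : E) := by fun_prop
    have := hcont.tendsto k
    rwa [hk, Prod.mk.eta, φ.symm_apply_apply] at this
  have hisolated : ∀ᶠ κ : K in 𝓝 k, (κ : ℕ → ℝ) = k := by
    filter_upwards [hslice.eventually hk₀] with κ hκ
    have hκ₀ : κ = k₀ := by
      simpa only [Subtype.coe_eta, φ.apply_symm_apply] using hκ (φ.symm _).2
    rw [hκ₀, ← hk₀.self_of_nhdsWithin hx hxU]
  have hacc := accPt_iff_frequently.1 (hK.2.2.1.acc k k.2)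
  rw [eventually_nhds_subtype_iff K k (fun κ => κ = (k : ℕ → ℝ)), eventually_nhdsWithin_iff]
    at hisolated
  obtain ⟨κ, ⟨hne, hκK⟩, hκ⟩ := (hacc.and_eventually hisolated).exists
  exact hne (hκ hκK)

end LocallyConnected

section Renormalizable

variable {s q : ℝ} {x y : ℕ → ℝ} {N : ℕ}

lemma follow_one_fixedPt (hs : 0 < s) (l : ℕ) : follow s 1 (fixedPt s) l = fixedPt s := by
  induction l with
  | zero => rfl
  | succ l ih => rw [follow_one_succ, ih, one_sub_fixedPt_div hs]

lemma abs_follow_one_sub_fixedPt (hs : 0 < s) (q : ℝ) (l : ℕ) :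
    |follow s 1 q l - fixedPt s| = |q - fixedPt s| / s ^ l := by
  rw [← abs_follow_sub_follow hs.le q (fixedPt s) l, follow_one_fixedPt hs]

lemma tendsto_rightLift_apply (hs : 1 < s) (N : ℕ) (q : ℝ) :
    Tendsto (rightLift s N q) atTop (𝓝 (fixedPt s)) := by
  refine (tendsto_add_atTop_iff_nat N).1 (tendsto_iff_dist_tendsto_zero.2 ?_)
  simp only [Nat.add_comm _ N, rightLift_apply_add, Real.dist_eq,
    abs_follow_one_sub_fixedPt (zero_lt_one.trans hs)]
  exact (tendsto_pow_atTop_atTop_of_one_lt hs).const_div_atTop _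

lemma eq_rightLift (hs : 1 ≤ s) (hy : y ∈ coreSpace s)
    (hyN : |y N - fixedPt s| < critOrbit s 3 - fixedPt s) : y = rightLift s N (y N) := by
  have hs0 : 0 < s := by linarith
  have hright {l : ℕ} (h : y (N + l) = follow s 1 (y N) l) : crit < y (N + l + 1) := by
    refine crit_lt_of_tent_lt_critOrbit_three hs (hy.1 _).1 ?_
    have hdist : |follow s 1 (y N) l - fixedPt s| < critOrbit s 3 - fixedPt s := by
      rw [abs_follow_one_sub_fixedPt hs0]
      exact (div_le_self (abs_nonneg _) (one_le_pow₀ hs)).trans_lt hyN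
    rw [hy.2, h]
    linarith [(abs_lt.1 hdist).2]
  have hfollow (l : ℕ) : y (N + l) = follow s 1 (y N) l := by
    induction l with
    | zero => rfl
    | succ l ih =>
      rw [follow_one_succ, ← ih]
      exact eq_one_sub_div_of_tent_eq hs0 (hright ih).le (hy.2 _)
  rw [rightLift, ← funext hfollow, iterate_shift_drop hy]

lemma nhdsWithin_coreSpace_eq_map (hs : 1 ≤ s) (hs2 : s ≤ 2) (hx : x ∈ coreSpace s)
    (hxN : |x N - fixedPt s| < critOrbit s 3 - fixedPt s) (hx2 : critOrbit s 2 < x N) :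
    𝓝[coreSpace s] x = map (rightLift s N) (𝓝 (x N)) := by
  have hnear : ∀ᶠ u in 𝓝 (x N), |u - fixedPt s| < critOrbit s 3 - fixedPt s :=
    (continuous_id.sub continuous_const).abs.continuousAt.eventually_lt_const hxN
  have hcore : ∀ᶠ u in 𝓝 (x N), u ∈ core s := by
    filter_upwards [hnear, lt_mem_nhds hx2] with u hu hu2
    exact ⟨hu2.le, by linarith [(abs_lt.1 hu).2, (critOrbit_mem_core hs hs2 3).2]⟩
  have hproj : Tendsto (fun y : ℕ → ℝ => y N) (𝓝[coreSpace s] x) (𝓝 (x N)) :=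
    (continuous_apply N).continuousAt.mono_left nhdsWithin_le_nhds
  apply le_antisymm
  · intro V hV
    filter_upwards [hproj.eventually (hnear.and (mem_map.1 hV)), self_mem_nhdsWithin]
      with y ⟨hyN, hyV⟩ hy
    rwa [eq_rightLift hs hy hyN]
  · refine tendsto_nhdsWithin_iff.2 ⟨?_, hcore.mono fun u => rightLift_mem_coreSpace hs hs2 N⟩
    have := (continuous_rightLift s N).tendsto (x N)
    rwa [← eq_rightLift hs hx hxN] at this

lemma crit_lt_fixedPt (hs : 1 < s) : crit < fixedPt s := by
  rw [fixedPt, crit, lt_div_iff₀ (by linarith)]; linarith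

lemma rightLift_mem_foldingPoints (hs : 1 < s) (hs2 : s ≤ 2) (h2 : s ^ 2 < 2) (N : ℕ)
    (hq : q ∈ core s) : rightLift s N q ∈ foldingPoints s := by
  have hmem := rightLift_mem_coreSpace hs.le hs2 N hq
  have hlim := tendsto_rightLift_apply hs N q
  have hdist : Tendsto (fun n => |rightLift s N q n - fixedPt s|) atTop (𝓝 0) := by
    simpa only [sub_self, abs_zero] using (hlim.sub_const (fixedPt s)).abs
  obtain ⟨n, hn, hn2⟩ := ((hdist.eventually_lt_const
    (sub_pos.2 ((fixedPt_lt_critOrbit_three_iff hs).2 h2))).and (hlim.eventually_const_lt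
      ((critOrbit_two_le_crit hs.le).trans_lt (crit_lt_fixedPt hs)))).exists
  exact ⟨hmem, not_hasCantorArcNhd_of_nhdsWithin_eq_map (continuous_rightLift s n) hmem
    (nhdsWithin_coreSpace_eq_map hs.le hs2 hmem hn hn2)⟩

lemma rightLift_notMem_endpoints (hs : 1 < s) (hs2 : s ≤ 2) (N : ℕ) (hq : q ∈ core s) :
    rightLift s N q ∉ endpoints (space s) := by
  have hcrit := crit_lt_fixedPt hs
  have hone : fixedPt s < 1 := by rw [fixedPt, div_lt_one (by linarith)]; linarith
  obtain ⟨a, ha, ha'⟩ := exists_between hcrit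
  obtain ⟨b, hb, hb'⟩ := exists_between hone
  refine notMem_endpoints_of_eventually_mem hs.le hs2 (isCompact_Icc (a := a) (b := b)) ?_
    (invLim_mono (core_subset_Icc hs.le hs2) (rightLift_mem_coreSpace hs.le hs2 N hq))
    ((tendsto_rightLift_apply hs N q).eventually (Icc_mem_nhds ha' hb))
  refine fun u hu => ⟨⟨?_, hu.2.trans_lt hb'⟩, (ha.trans_le hu.1).ne'⟩
  exact lt_of_lt_of_le (by norm_num [crit]) (ha.le.trans hu.1)

lemma coreSpace_subset_closure (hs : 1 < s) (hs2 : s ≤ 2) (h2 : s ^ 2 < 2) :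
    coreSpace s ⊆ closure (foldingPoints s \ endpoints (space s)) := fun y hy =>
  mem_closure_of_frequently_apply (continuous_tent s) (fun _ hx => hx.1.1) hy <|
    Frequently.of_forall fun M => subset_closure ⟨rightLift s M (y M),
      ⟨rightLift_mem_foldingPoints hs hs2 h2 M (hy.1 M),
        rightLift_notMem_endpoints hs hs2 M (hy.1 M)⟩, rightLift_apply_self s M (y M)⟩

end Renormalizable

end TentInverseLimit

open TentInverseLimit in
theorem proposition4p8_general (s : ℝ) (hs1 : 1 < s) (hs2 : s ≤ 2) :
    ((foldingPoints s \ endpoints (space s)).Nonempty →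
      foldingPoints s ⊆ closure (foldingPoints s \ endpoints (space s))) ∧
    ((omegaSpace s \ endpoints (space s)).Nonempty →
      omegaSpace s ⊆ closure (omegaSpace s \ endpoints (space s))) := by
  have homega (hne : (omegaSpace s \ endpoints (space s)).Nonempty) :
      omegaSpace s ⊆ closure (omegaSpace s \ endpoints (space s)) := by
    rcases hs2.lt_or_eq with hlt | rfl
    · exact omegaSpace_subset_closure hs1.le hlt hne
    · obtain ⟨x, hx⟩ := hne
      intro y hy
      exact subset_closure (subsingleton_omegaSpace_two hy hx.1 ▸ hx)
  refine ⟨fun hne => ?_, homega⟩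
  rcases lt_or_ge (s ^ 2) 2 with h2 | h2
  · exact fun x hx => coreSpace_subset_closure hs1 hs2 h2 hx.1
  · have hfold : foldingPoints s = omegaSpace s :=
      (foldingPoints_subset_omegaSpace hs1 hs2 h2).antisymm
        (omegaSpace_subset_foldingPoints hs1.le hs2)
    rw [hfold] at hne ⊢
    exact homega hne

theorem proposition4p8 (s : ℝ) (hs1 : 1 < s) (hs2 : s ≤ 2)
    (horb : (Set.range (TentInverseLimit.critOrbit s)).Infinite) :
    ((TentInverseLimit.foldingPoints s \
          TentInverseLimit.endpoints (TentInverseLimit.space s)).Nonempty →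
      TentInverseLimit.foldingPoints s ⊆
        closure (TentInverseLimit.foldingPoints s \
          TentInverseLimit.endpoints (TentInverseLimit.space s))) ∧
    ((TentInverseLimit.omegaSpace s \
          TentInverseLimit.endpoints (TentInverseLimit.space s)).Nonempty →
      TentInverseLimit.omegaSpace s ⊆
        closure (TentInverseLimit.omegaSpace s \
          TentInverseLimit.endpoints (TentInverseLimit.space s))) :=
  proposition4p8_general s hs1 hs2
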